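/- For a compact set $K\subset\mathbb{R}$ of positive Lebesgue measure $|K|=\lambda(K)>0$, let $L^\infty(K)$ be the real space of (classes of) essentially bounded functions on $K$. For $f\in L^\infty(K)$ put $$J_Kf(x)=\int_{[\min K,x]\cap K} f\,d\lambda\quad(x\in K),\qquad \|f\|_A=\sup_{x\in K}|J_Kf(x)|,$$ where $\|\cdot\|_A$ is called the Alexiewicz norm. Let $\pi_K:K\to[0,|K|]$, $\pi_K(x)=\lambda([\min K,x]\cap K)$, and $\sigma_K:[0,|K|]\to K$, $\sigma_K(t)=\min\{x\in K:\pi_K(x)=t\}$. Theorem. Let $K,M\subset\mathbb{R}$ be compact sets of positive Lebesgue measure. A linear map $T:(L^\infty(K),\|\cdot\|_A)\to(L^\infty(M),\|\cdot\|_A)$ is a surjective isometry if and only if there exist $\varepsilon\in\{1,-1\}$ and an increasing bi-Lipschitz homeomorphism $\psi:[0,|M|]\to[0,|K|]$ such that the map $\phi=\sigma_K\circ\psi\circ\pi_M:M\to K$ satisfies $$J_M(Tf)(y)=\varepsilon\,(J_Kf)(\phi(y))\qquad\text{for all } y\in M \tag{1}$$ for every $f\in L^\infty(K)$. Moreover,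 for every linear map $T:L^\infty(K)\to L^\infty(M)$, every such $\varepsilon$ and $\psi$ (with $\phi=\sigma_K\circ\psi\circ\pi_M$) and every $f\in L^\infty(K)$, condition (1) is equivalent to $$(Tf)(y)=\varepsilon\,f(\phi(y))\,\psi'(\pi_M(y))\qquad\text{for a.e. } y\in M. \tag{2}$$ -/

import Mathlib

namespace Alexiewicz

open MeasureTheory Set

/-- The real space `L^∞(K)` for Lebesgue measure on `K ⊆ ℝ`
(classes of essentially bounded functions modulo equality a.e. on `K`). -/
abbrev LInf (K : Set ℝ) : Type :=
  Lp ℝ ⊤ ((volume : Measure ℝ).restrict K)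

/-- The primitive `J_K f (x) = ∫_{[min K, x] ∩ K} f dλ`. For nonempty compact `K`, `sInf K` is
`min K`. -/
noncomputable def primitive (K : Set ℝ) (f : LInf K) (x : ℝ) : ℝ :=
  ∫ u in Icc (sInf K) x ∩ K, f u

/-- The Alexiewicz norm `‖f‖_A = sup_{x ∈ K} |J_K f (x)|`. -/
noncomputable def alexNorm (K : Set ℝ) (f : LInf K) : ℝ :=
  sSup ((fun x => |primitive K f x|) '' K)

/-- The measure projection `π_K(x) = λ([min K, x] ∩ K)`. -/
noncomputable def proj (K : Set ℝ) (x : ℝ) : ℝ :=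
  volume.real (Icc (sInf K) x ∩ K)

/-- The left-endpoint selector `σ_K(t) = min {x ∈ K : π_K(x) = t}`, used for `t ∈ [0, |K|]`. If `K`
is compact of positive measure, that fiber is nonempty and compact, so `sInf` is its minimum. -/
noncomputable def sel (K : Set ℝ) (t : ℝ) : ℝ :=
  sInf {x ∈ K | proj K x = t}

/-- `ψ` restricts to an increasing lipeomorphism (bi-Lipschitz homeomorphism)
`[0, a] → [0, b]`. Values of `ψ` outside `[0, a]` are irrelevant. -/
structure IsIncreasingLipeo (a b : ℝ) (ψ : ℝ → ℝ) : Prop where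
  strictMonoOn : StrictMonoOn ψ (Icc 0 a)
  bijOn : BijOn ψ (Icc 0 a) (Icc 0 b)
  lipschitz : ∃ C, LipschitzOnWith C ψ (Icc 0 a)
  antilipschitz : ∃ C, AntilipschitzWith C (fun t : Icc (0 : ℝ) a => ψ t)

/-- `φ = σ_K ∘ ψ ∘ π_M`, used on `M`. -/
noncomputable def lift (K M : Set ℝ) (ψ : ℝ → ℝ) (y : ℝ) : ℝ :=
  sel K (ψ (proj M y))

/-- `T` is a surjective isometry `(L^∞(K), ‖·‖_A) → (L^∞(M), ‖·‖_A)`. -/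
def IsSurjectiveIsometry {K M : Set ℝ} (T : LInf K →ₗ[ℝ] LInf M) : Prop :=
  Function.Surjective T ∧ ∀ f : LInf K, alexNorm M (T f) = alexNorm K f

end Alexiewicz

/-! The projection `π_K` and the selector `σ_K` identify `K`, up to null sets, with `[0, |K|]`, and
`J_K f` becomes the ordinary primitive of `f ∘ σ_K`. The primitives obtained are exactly the
Lipschitz functions on `[0, |K|]` vanishing at `0` (`rangeLip_transportedPrimitive`), and the
Alexiewicz norm is their sup norm (`alexNorm_le_iff`).

A surjective isometry thus becomes one between two such Lipschitz spaces, and a Banach–Stone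
argument applies (`exists_lipeo_of_sup_isometry`). The functions of norm one with value `1` at `x`
form a convex family; by compactness their images all take one common value `±1` at some point `y`.
A function vanishing at `x`, once scaled, can be added to a steep tent without leaving the family,
so its image vanishes at `y`. Hence evaluation at `y` is, up to sign, evaluation at `x`. The image
of the identity function shows that the sign is constant and that the point map is Lipschitz.

The a.e. formula follows from change of variables for `ψ` and Lebesgue differentiation
(`transported_lift_iff_ae`). -/

namespace Alexiewicz

open MeasureTheory Set
open scoped NNReal

/-! ### Banach–Stone theorem for Lipschitz functions vanishing at `0` -/

section Core

variable {X : Type*} [AddCommGroup X] [Module ℝ X]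

/-- The linear map `A` has values in the functions that are Lipschitz on `[0, a]` and vanish at `0`,
and every such function is attained. -/
structure RangeLip (a : ℝ) (A : X →ₗ[ℝ] (ℝ → ℝ)) : Prop where
  lipschitz : ∀ f, ∃ C, LipschitzOnWith C (A f) (Icc 0 a)
  zero : ∀ f, A f 0 = 0
  surj : ∀ (F : ℝ → ℝ) (C : ℝ≥0), LipschitzOnWith C F (Icc 0 a) → F 0 = 0 →
    ∃ f, ∀ t ∈ Icc 0 a, A f t = F t

/-- A Lipschitz function vanishing at `x` is dominated by a multiple of the distance to `x`, so
adding a small multiple of it to a steep tent at `x` does not increase the sup norm. -/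
lemma abs_tent_add_le {L c x t v : ℝ} (hL : 0 ≤ L) (hc : L ≤ c) (hv : |v| ≤ L * |t - x|)
    (hv1 : |v| ≤ 1) : |max 0 (1 - c * |t - x|) + v| ≤ 1 := by
  have h0 := abs_nonneg (t - x)
  have h1 : L * |t - x| ≤ c * |t - x| := mul_le_mul_of_nonneg_right hc h0
  have h2 : 0 ≤ c * |t - x| := mul_nonneg (hL.trans hc) h0
  rw [abs_le] at hv hv1 ⊢
  rcases max_cases 0 (1 - c * |t - x|) with ⟨h, h'⟩ | ⟨h, h'⟩ <;> rw [h] <;>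
    constructor <;> linarith [hv.1, hv.2, hv1.1, hv1.2]

lemma lipschitzWith_tent (c : ℝ≥0) (x : ℝ) :
    LipschitzWith c fun t : ℝ => max 0 (1 - c * |t - x|) := by
  refine LipschitzWith.const_max ?_ 0
  refine LipschitzWith.of_dist_le_mul fun s t => ?_
  rw [Real.dist_eq, Real.dist_eq]
  have h : (1 - c * |s - x|) - (1 - c * |t - x|) = c * (|t - x| - |s - x|) := by ring
  rw [h, abs_mul, NNReal.abs_eq, abs_sub_comm s t]
  refine mul_le_mul_of_nonneg_left ?_ c.2
  have := abs_abs_sub_abs_le_abs_sub (t - x) (s - x)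
  simpa using this

variable {a b : ℝ} {A B : X →ₗ[ℝ] (ℝ → ℝ)}

lemma RangeLip.continuousOn (hA : RangeLip a A) (f : X) : ContinuousOn (A f) (Icc 0 a) :=
  let ⟨_, h⟩ := hA.lipschitz f
  h.continuousOn

/-- A function of sup norm one attains the value `±1`. -/
lemma exists_abs_eq_one (hb : 0 < b) (hB : RangeLip b B)
    (hAB : ∀ f c, (∀ t ∈ Icc 0 a, |A f t| ≤ c) ↔ ∀ t ∈ Icc 0 b, |B f t| ≤ c)
    {f : X} (hf : ∀ t ∈ Icc 0 a, |A f t| ≤ 1) {x : ℝ} (hx : x ∈ Icc 0 a) (hfx : A f x = 1) :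
    ∃ y ∈ Icc 0 b, |B f y| = 1 := by
  obtain ⟨y, hy, hmax⟩ := isCompact_Icc.exists_isMaxOn (nonempty_Icc.2 hb.le)
    (hB.continuousOn f).abs
  refine ⟨y, hy, le_antisymm ((hAB f 1).1 hf y hy) ?_⟩
  have := (hAB f (|B f y|)).2 (fun t ht => hmax ht) x hx
  rwa [hfx, abs_one] at this

/-- All functions peaking at `x` are mapped to functions taking a common value `±1` at one common
point. -/
lemma exists_common_peak (hb : 0 < b) (hB : RangeLip b B)
    (hAB : ∀ f c, (∀ t ∈ Icc 0 a, |A f t| ≤ c) ↔ ∀ t ∈ Icc 0 b, |B f t| ≤ c)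
    {x : ℝ} (hx : x ∈ Icc 0 a) {g : X} (hg : ∀ t ∈ Icc 0 a, |A g t| ≤ 1) (hgx : A g x = 1) :
    ∃ y ∈ Icc 0 b, |B g y| = 1 ∧
      ∀ f, (∀ t ∈ Icc 0 a, |A f t| ≤ 1) → A f x = 1 → B f y = B g y := by
  let I := {f : X // (∀ t ∈ Icc 0 a, |A f t| ≤ 1) ∧ A f x = 1}
  let Z : I → Set ℝ := fun f => {y ∈ Icc 0 b | B f y - B g y = 0 ∧ |B f y| = 1}
  have : Nonempty I := ⟨⟨g, hg, hgx⟩⟩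
  have mid : ∀ f f' : I, ∃ k : I, (k : X) = (1 / 2 : ℝ) • ((f : X) + f') := by
    rintro ⟨f, hf, hfx⟩ ⟨f', hf', hfx'⟩
    refine ⟨⟨_, fun t ht => ?_, ?_⟩, rfl⟩
    · have h1 := abs_le.1 (hf t ht)
      have h2 := abs_le.1 (hf' t ht)
      simp only [map_smul, map_add, Pi.smul_apply, Pi.add_apply, smul_eq_mul]
      rw [abs_le]
      constructor <;> linarith
    · simp only [map_smul, map_add, Pi.smul_apply, Pi.add_apply, smul_eq_mul, hfx, hfx']
      norm_num
  -- `±1` are extreme points of `[-1, 1]`: where a midpoint has modulus one, both of its ends agree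
  -- with it.
  have split : ∀ f f' k : I, (k : X) = (1 / 2 : ℝ) • ((f : X) + f') → ∀ y ∈ Icc 0 b,
      |B k y| = 1 → B f y = B k y ∧ B f' y = B k y := by
    intro f f' k hk y hy h
    have e : B k y = 1 / 2 * (B f y + B f' y) := by
      rw [hk]; simp only [map_smul, map_add, Pi.smul_apply, Pi.add_apply, smul_eq_mul]
    have h1 := abs_le.1 ((hAB f 1).1 f.2.1 y hy)
    have h2 := abs_le.1 ((hAB f' 1).1 f'.2.1 y hy)
    rcases (abs_eq zero_le_one).1 h with h | h <;> constructor <;> linarith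
  have hclosed : ∀ f, IsClosed (Z f) := by
    intro f
    have h1 : Z f = (Icc 0 b ∩ (fun y => B f y - B g y) ⁻¹' {0}) ∩
        (Icc 0 b ∩ (fun y => |B f y|) ⁻¹' {1}) := by
      ext y
      simp only [Z, mem_ofPred_eq, mem_inter_iff, mem_preimage, mem_singleton_iff]
      tauto
    rw [h1]
    exact (((hB.continuousOn f).sub (hB.continuousOn g)).preimage_isClosed_of_isClosed isClosed_Icc
      isClosed_singleton).inter ((hB.continuousOn f).abs.preimage_isClosed_of_isClosed isClosed_Icc
      isClosed_singleton)
  -- The family `Z` is directed downwards because `Z` of a midpoint lies in `Z` of both ends.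
  obtain ⟨y, hy⟩ := IsCompact.nonempty_iInter_of_directed_nonempty_isCompact_isClosed Z
    (by
      intro f f'
      obtain ⟨k, hk⟩ := mid f f'
      refine ⟨k, ?_, ?_⟩ <;> rintro y ⟨hy, h0, h1⟩ <;>
        obtain ⟨e1, e2⟩ := split f f' k hk y hy h1
      · exact ⟨hy, by rw [e1, h0], by rw [e1, h1]⟩
      · exact ⟨hy, by rw [e2, h0], by rw [e2, h1]⟩)
    (by
      intro f
      obtain ⟨k, hk⟩ := mid f ⟨g, hg, hgx⟩
      obtain ⟨y, hy, h1⟩ := exists_abs_eq_one hb hB hAB k.2.1 hx k.2.2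
      obtain ⟨e1, e2⟩ := split _ _ k hk y hy h1
      exact ⟨y, hy, by rw [e1, ← e2, sub_self], by rw [e1, h1]⟩)
    (fun f => isCompact_Icc.of_isClosed_subset (hclosed f) fun _ h => h.1) hclosed
  rw [mem_iInter] at hy
  refine ⟨y, (hy ⟨g, hg, hgx⟩).1, (hy ⟨g, hg, hgx⟩).2.2, fun f hf hfx => ?_⟩
  exact sub_eq_zero.1 (hy ⟨f, hf, hfx⟩).2.1

/-- Evaluation at `x` is, up to sign, the pullback of an evaluation under the isometry. -/
lemma exists_eval_eq (hb : 0 < b) (hA : RangeLip a A) (hB : RangeLip b B)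
    (hAB : ∀ f c, (∀ t ∈ Icc 0 a, |A f t| ≤ c) ↔ ∀ t ∈ Icc 0 b, |B f t| ≤ c)
    {x : ℝ} (hx : x ∈ Ioc 0 a) :
    ∃ y ∈ Ioc 0 b, ∃ s : ℝ, (s = 1 ∨ s = -1) ∧ ∀ f, B f y = s * A f x := by
  have hx' : x ∈ Icc 0 a := ⟨hx.1.le, hx.2⟩
  -- The condition `1 ≤ c * x` makes the tent vanish at `0`.
  have tent : ∀ c : ℝ≥0, 1 ≤ c * x → ∃ g, ∀ t ∈ Icc 0 a, A g t = max 0 (1 - c * |t - x|) := by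
    intro c hc
    refine hA.surj _ c (lipschitzWith_tent c x).lipschitzOnWith ?_
    rw [zero_sub, abs_neg, abs_of_pos hx.1]
    exact max_eq_left (by linarith)
  have peak : ∀ (c : ℝ≥0) (g : X), (∀ t ∈ Icc 0 a, A g t = max 0 (1 - c * |t - x|)) →
      (∀ t ∈ Icc 0 a, |A g t| ≤ 1) ∧ A g x = 1 := by
    intro c g hg
    refine ⟨fun t ht => ?_, by rw [hg x hx']; simp⟩
    rw [hg t ht]
    simpa using abs_tent_add_le (v := 0) (x := x) (t := t) le_rfl c.2 (by simp) (by simp)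
  obtain ⟨g, hg⟩ := tent (Real.toNNReal (1 / x)) (by
    rw [Real.coe_toNNReal _ (by have := hx.1; positivity), one_div_mul_cancel hx.1.ne'])
  obtain ⟨hg1, hgx⟩ := peak _ g hg
  obtain ⟨y, hy, hgy, H⟩ := exists_common_peak hb hB hAB hx' hg1 hgx
  have hy0 : y ≠ 0 := by
    rintro rfl
    rw [hB.zero] at hgy
    norm_num at hgy
  have vanish : ∀ f, A f x = 0 → B f y = 0 := by
    intro f hf
    obtain ⟨L, hL⟩ := hA.lipschitz f
    obtain ⟨N, hN⟩ := isCompact_Icc.exists_bound_of_continuousOn (hA.continuousOn f)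
    have hN0 : 0 < |N| + 1 := by positivity
    set δ : ℝ := 1 / (|N| + 1) with hδ
    have hδ0 : 0 < δ := by positivity
    have hbd : ∀ t ∈ Icc 0 a, |δ * A f t| ≤ 1 := by
      intro t ht
      have := (hN t ht).trans ((le_abs_self N).trans (le_add_of_nonneg_right zero_le_one))
      rw [abs_mul, abs_of_pos hδ0, hδ, one_div, inv_mul_le_one₀ hN0]
      exact this
    have hlip : ∀ t ∈ Icc 0 a, |δ * A f t| ≤ δ * L * |t - x| := by
      intro t ht
      have := hL.dist_le_mul t ht x hx'
      rw [Real.dist_eq, Real.dist_eq, hf, sub_zero] at this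
      rw [abs_mul, abs_of_pos hδ0, mul_assoc]
      exact mul_le_mul_of_nonneg_left this hδ0.le
    -- The slope dominates the Lipschitz constant of `δ * A f`, which keeps the perturbed tent below
    -- one in modulus, and is at least `1 / x`, as `tent` requires.
    let c : ℝ≥0 := Real.toNNReal (max (δ * L) (1 / x))
    have hc : (c : ℝ) = max (δ * L) (1 / x) :=
      Real.coe_toNNReal _ (le_max_of_le_left (by positivity))
    obtain ⟨k, hk⟩ := tent c (by
      have h1 : 1 / x ≤ c := by rw [hc]; exact le_max_right _ _
      rwa [div_le_iff₀ hx.1] at h1)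
    obtain ⟨hk1, hkx⟩ := peak c k hk
    have h1 := H k hk1 hkx
    have h2 := H (k + δ • f) (fun t ht => by
      simp only [map_smul, map_add, Pi.smul_apply, Pi.add_apply, smul_eq_mul]
      rw [hk t ht]
      exact abs_tent_add_le (by positivity) (by rw [hc]; exact le_max_left _ _) (hlip t ht)
        (hbd t ht)) (by
      simp only [map_smul, map_add, Pi.smul_apply, Pi.add_apply, smul_eq_mul, hf, hkx]
      ring)
    simp only [map_smul, map_add, Pi.smul_apply, Pi.add_apply, smul_eq_mul] at h2
    have h3 : δ * B f y = 0 := by linarith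
    exact (mul_eq_zero.1 h3).resolve_left hδ0.ne'
  refine ⟨y, ⟨lt_of_le_of_ne hy.1 hy0.symm, hy.2⟩, B g y, (abs_eq zero_le_one).1 hgy, fun f => ?_⟩
  have := vanish (f - A f x • g) (by
    simp only [map_smul, map_sub, Pi.smul_apply, Pi.sub_apply, smul_eq_mul, hgx]
    ring)
  simp only [map_smul, map_sub, Pi.smul_apply, Pi.sub_apply, smul_eq_mul] at this
  linarith

/-- The Banach–Stone theorem for the Lipschitz functions vanishing at `0`, with the sup norm. -/
theorem exists_lipeo_of_sup_isometry (ha : 0 < a) (hb : 0 < b) (hA : RangeLip a A)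
    (hB : RangeLip b B)
    (hAB : ∀ f c, (∀ t ∈ Icc 0 a, |A f t| ≤ c) ↔ ∀ t ∈ Icc 0 b, |B f t| ≤ c) :
    ∃ ε : ℝ, (ε = 1 ∨ ε = -1) ∧ ∃ ψ : ℝ → ℝ, IsIncreasingLipeo b a ψ ∧
      ∀ f, ∀ y ∈ Icc 0 b, B f y = ε * A f (ψ y) := by
  have hfwd := fun y (hy : y ∈ Ioc 0 b) =>
    exists_eval_eq ha hB hA (fun f c => (hAB f c).symm) hy
  have hbwd := fun x (hx : x ∈ Ioc 0 a) => exists_eval_eq hb hA hB hAB hx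
  choose! ψ hψ s hs hψs using hfwd
  choose! η hη r hr hηr using hbwd
  -- Testing on the preimages of the identity functions recovers the points themselves up to sign;
  -- positivity removes the sign.
  obtain ⟨i, hi⟩ := hA.surj id 1 LipschitzWith.id.lipschitzOnWith rfl
  obtain ⟨j, hj⟩ := hB.surj id 1 LipschitzWith.id.lipschitzOnWith rfl
  have Ioc_Icc : ∀ {c t : ℝ}, t ∈ Ioc 0 c → t ∈ Icc 0 c := fun h => ⟨h.1.le, h.2⟩
  have fwd : ∀ y ∈ Ioc 0 b, ∀ f, B f y = s y * A f (ψ y) := by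
    intro y hy f
    rw [hψs y hy f]
    rcases hs y hy with h | h <;> rw [h] <;> ring
  have hψη : ∀ x ∈ Ioc 0 a, ψ (η x) = x := by
    intro x hx
    have h1 := hηr x hx i
    rw [fwd _ (hη x hx), hi _ (Ioc_Icc (hψ _ (hη x hx))), hi x (Ioc_Icc hx)] at h1
    have p1 := (hψ _ (hη x hx)).1
    have p2 := hx.1
    simp only [id] at h1
    rcases hs _ (hη x hx) with h | h <;> rcases hr x hx with h' | h' <;> rw [h, h'] at h1 <;>
      linarith
  have hηψ : ∀ y ∈ Ioc 0 b, η (ψ y) = y := by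
    intro y hy
    have h1 := hψs y hy j
    have h2 := hηr _ (hψ y hy) j
    rw [hj _ (Ioc_Icc (hη _ (hψ y hy)))] at h2
    rw [hj y (Ioc_Icc hy)] at h1
    have p1 := (hη _ (hψ y hy)).1
    have p2 := hy.1
    simp only [id] at h1 h2
    rcases hs _ hy with h | h <;> rcases hr _ (hψ y hy) with h' | h' <;> rw [h] at h1 <;>
      rw [h'] at h2 <;> linarith
  have hBi : ∀ y ∈ Ioc 0 b, B i y = s y * ψ y := fun y hy => by
    rw [fwd y hy, hi _ (Ioc_Icc (hψ y hy)), id]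
  -- `B i y = s y * ψ y` is continuous and has no zero on `(0, b]`, so a change of sign would
  -- contradict the intermediate value theorem.
  have hconst : ∀ y ∈ Ioc 0 b, s y = s b := by
    intro y hy
    have hbb : b ∈ Ioc 0 b := ⟨hb, le_rfl⟩
    by_contra hne
    have hsub : Icc y b ⊆ Icc 0 b := Icc_subset_Icc_left hy.1.le
    have hp1 := (hψ y hy).1
    have hp2 := (hψ b hbb).1
    have hz : (0 : ℝ) ∈ B i '' Icc y b := by
      have hcont := (hB.continuousOn i).mono hsub
      rcases hs y hy with h | h <;> rcases hs b hbb with h' | h'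
      · exact absurd (h.trans h'.symm) hne
      · refine intermediate_value_Icc' hy.2 hcont ?_
        rw [hBi y hy, hBi b hbb, h, h']
        constructor <;> linarith
      · refine intermediate_value_Icc hy.2 hcont ?_
        rw [hBi y hy, hBi b hbb, h, h']
        constructor <;> linarith
      · exact absurd (h.trans h'.symm) hne
    obtain ⟨z, hz, hz0⟩ := hz
    have hz' : z ∈ Ioc 0 b := ⟨hy.1.trans_le hz.1, hz.2⟩
    have := (hψ z hz').1
    rw [hBi z hz'] at hz0
    rcases hs z hz' with h | h <;> rw [h] at hz0 <;> linarith
  set ε := s b with hε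
  have hε1 : ε = 1 ∨ ε = -1 := hs b ⟨hb, le_rfl⟩
  have hεε : ε * ε = 1 := by rcases hε1 with h | h <;> rw [h] <;> norm_num
  have key : ∀ f, ∀ y ∈ Icc 0 b, B f y = ε * A f (ε * B i y) := by
    intro f y hy
    rcases hy.1.eq_or_lt with rfl | h0
    · rw [hB.zero, hB.zero, mul_zero, hA.zero, mul_zero]
    · rw [hBi y ⟨h0, hy.2⟩, fwd y ⟨h0, hy.2⟩, hconst y ⟨h0, hy.2⟩, ← mul_assoc, hεε, one_mul]
  -- The chosen `ψ` is arbitrary at `0`. This formula agrees with it on `(0, b]`, gives `0` at `0`,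
  -- and is visibly Lipschitz; `H` does the same for the inverse.
  set Ψ : ℝ → ℝ := fun y => ε * B i y with hΨ
  set H : ℝ → ℝ := fun x => ε * A j x with hH
  have hΨ0 : Ψ 0 = 0 := by simp only [hΨ, hB.zero, mul_zero]
  have hH0 : H 0 = 0 := by simp only [hH, hA.zero, mul_zero]
  have hΨψ : ∀ y ∈ Ioc 0 b, Ψ y = ψ y := fun y hy => by
    simp only [hΨ]
    rw [hBi y hy, hconst y hy, ← mul_assoc, hεε, one_mul]
  have hHη : ∀ x ∈ Ioc 0 a, H x = η x := fun x hx => by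
    have h1 := hψs _ (hη x hx) j
    rw [hψη x hx, hconst _ (hη x hx), hj _ (Ioc_Icc (hη x hx))] at h1
    simp only [hH]
    rw [h1, ← mul_assoc, hεε, one_mul, id]
  have mapsΨ : MapsTo Ψ (Icc 0 b) (Icc 0 a) := by
    intro y hy
    rcases hy.1.eq_or_lt with rfl | h0
    · rw [hΨ0]; exact ⟨le_rfl, ha.le⟩
    · rw [hΨψ y ⟨h0, hy.2⟩]; exact Ioc_Icc (hψ y ⟨h0, hy.2⟩)
  have mapsH : MapsTo H (Icc 0 a) (Icc 0 b) := by
    intro x hx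
    rcases hx.1.eq_or_lt with rfl | h0
    · rw [hH0]; exact ⟨le_rfl, hb.le⟩
    · rw [hHη x ⟨h0, hx.2⟩]; exact Ioc_Icc (hη x ⟨h0, hx.2⟩)
  have linv : LeftInvOn H Ψ (Icc 0 b) := by
    intro y hy
    rcases hy.1.eq_or_lt with rfl | h0
    · rw [hΨ0, hH0]
    · have h := hψ y ⟨h0, hy.2⟩
      rw [hΨψ y ⟨h0, hy.2⟩, hHη _ h, hηψ y ⟨h0, hy.2⟩]
  have rinv : RightInvOn H Ψ (Icc 0 a) := by
    intro x hx
    rcases hx.1.eq_or_lt with rfl | h0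
    · rw [hH0, hΨ0]
    · have h := hη x ⟨h0, hx.2⟩
      rw [hHη x ⟨h0, hx.2⟩, hΨψ _ h, hψη x ⟨h0, hx.2⟩]
  have lip_mul : ∀ {C : ℝ≥0} {F : ℝ → ℝ} {u : Set ℝ}, LipschitzOnWith C F u →
      LipschitzOnWith C (fun t => ε * F t) u := by
    intro C F u h
    refine LipschitzOnWith.of_dist_le_mul fun p hp q hq => ?_
    have := h.dist_le_mul p hp q hq
    rw [Real.dist_eq, ← mul_sub, abs_mul]
    have h1 : |ε| = 1 := by rcases hε1 with h | h <;> rw [h] <;> norm_num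
    rw [h1, one_mul]
    exact this
  have bij : BijOn Ψ (Icc 0 b) (Icc 0 a) := InvOn.bijOn ⟨linv, rinv⟩ mapsΨ mapsH
  obtain ⟨C, hC⟩ := hB.lipschitz i
  obtain ⟨D, hD⟩ := hA.lipschitz j
  have hΨC : LipschitzOnWith C Ψ (Icc 0 b) := lip_mul hC
  have hHD : LipschitzOnWith D H (Icc 0 a) := lip_mul hD
  refine ⟨ε, hε1, Ψ, ⟨?_, bij, ⟨C, hΨC⟩, ⟨D, ?_⟩⟩, key⟩
  · refine ContinuousOn.strictMonoOn_of_injOn_Icc hb.le ?_ hΨC.continuousOn bij.injOn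
    rw [hΨ0]
    exact (mapsΨ ⟨hb.le, le_rfl⟩).1
  · refine AntilipschitzWith.of_le_mul_dist fun y z => ?_
    have := hHD.dist_le_mul _ (mapsΨ y.2) _ (mapsΨ z.2)
    rwa [linv y.2, linv z.2] at this

end Core

/-- Integrable functions on `[0, a]` with the same primitive agree a.e. -/
lemma ae_eq_of_primitive_eq {a : ℝ} (ha : 0 ≤ a) {F G : ℝ → ℝ} (hF : IntegrableOn F (Icc 0 a))
    (hG : IntegrableOn G (Icc 0 a))
    (h : ∀ t ∈ Icc 0 a, ∫ u in 0..t, F u = ∫ u in 0..t, G u) :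
    ∀ᵐ t ∂(volume.restrict (Icc 0 a)), F t = G t := by
  rw [← uIcc_of_le ha] at hF hG
  rw [← restrict_Ioo_eq_restrict_Icc, ae_restrict_iff' measurableSet_Ioo]
  filter_upwards [hF.intervalIntegrable.ae_hasDerivAt_integral,
    hG.intervalIntegrable.ae_hasDerivAt_integral] with t h1 h2 ht
  have ht' : t ∈ uIcc 0 a := by rw [uIcc_of_le ha]; exact Ioo_subset_Icc_self ht
  refine (h1 ht' 0 left_mem_uIcc).unique ((h2 ht' 0 left_mem_uIcc).congr_of_eventuallyEq ?_)
  filter_upwards [Icc_mem_nhds ht.1 ht.2] with u hu using h u hu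

/-! ### Transport between `K` and `[0, |K|]` -/

section Geometry

variable {K : Set ℝ}

lemma Icc_sInf_inter (hK : IsCompact K) (x : ℝ) : Icc (sInf K) x ∩ K = Iic x ∩ K := by
  ext u
  simp only [mem_inter_iff, mem_Icc, mem_Iic]
  exact ⟨fun h => ⟨h.1.2, h.2⟩, fun h => ⟨⟨csInf_le hK.bddBelow h.2, h.1⟩, h.2⟩⟩

lemma proj_eq (hK : IsCompact K) (x : ℝ) : proj K x = volume.real (Iic x ∩ K) := by
  rw [proj, Icc_sInf_inter hK]

lemma primitive_eq (hK : IsCompact K) (f : LInf K) (x : ℝ) :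
    primitive K f x = ∫ u in Iic x ∩ K, f u := by
  rw [primitive, Icc_sInf_inter hK]

lemma volume_inter_ne_top (hK : IsCompact K) (s : Set ℝ) : volume (s ∩ K) ≠ ⊤ :=
  measure_ne_top_of_subset inter_subset_right hK.measure_lt_top.ne

lemma proj_mono (hK : IsCompact K) : Monotone (proj K) := fun x y h => by
  rw [proj_eq hK, proj_eq hK]
  exact measureReal_mono (inter_subset_inter_left _ (Iic_subset_Iic.2 h))
    (volume_inter_ne_top hK _)

lemma proj_nonneg (x : ℝ) : 0 ≤ proj K x := measureReal_nonneg

lemma proj_le (hK : IsCompact K) (x : ℝ) : proj K x ≤ volume.real K :=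
  measureReal_mono inter_subset_right hK.measure_lt_top.ne

lemma proj_mem_Icc (hK : IsCompact K) (x : ℝ) : proj K x ∈ Icc 0 (volume.real K) :=
  ⟨proj_nonneg x, proj_le hK x⟩

lemma proj_lipschitz (hK : IsCompact K) : LipschitzWith 1 (proj K) := by
  refine LipschitzWith.of_le_add fun x y => ?_
  rcases le_total x y with h | h
  · exact (proj_mono hK h).trans (le_add_of_nonneg_right dist_nonneg)
  · rw [proj_eq hK, proj_eq hK]
    have hsub : Iic x ∩ K ⊆ (Iic y ∩ K) ∪ Icc y x := by
      rintro u ⟨hu, huK⟩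
      rcases le_total u y with h' | h'
      · exact Or.inl ⟨h', huK⟩
      · exact Or.inr ⟨h', hu⟩
    have h1 := measureReal_mono (μ := volume) hsub
      (measure_union_ne_top (volume_inter_ne_top hK _) measure_Icc_lt_top.ne)
    refine h1.trans ((measureReal_union_le _ _).trans ?_)
    rw [Real.volume_real_Icc_of_le h, Real.dist_eq, abs_of_nonneg (sub_nonneg.2 h)]

lemma exists_mem_proj_eq (hK : IsCompact K) (hne : K.Nonempty) {t : ℝ}
    (ht : t ∈ Icc 0 (volume.real K)) : ∃ x ∈ K, proj K x = t := by
  have hlo : proj K (sInf K) = 0 := by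
    rw [proj, Icc_self]
    exact measureReal_eq_zero_iff (volume_inter_ne_top hK _) |>.2
      (measure_mono_null inter_subset_left Real.volume_singleton)
  have hhi : proj K (sSup K) = volume.real K := by
    have hsub : K ⊆ Iic (sSup K) := fun x hx => le_csSup hK.bddAbove hx
    rw [proj_eq hK, inter_eq_right.2 hsub]
  have hle : sInf K ≤ sSup K := csInf_le_csSup hne hK.bddBelow hK.bddAbove
  obtain ⟨x, hx, hxt⟩ := intermediate_value_Icc hle (proj_lipschitz hK).continuous.continuousOn
    (by rwa [hlo, hhi] : t ∈ Icc (proj K (sInf K)) (proj K (sSup K)))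
  -- The point `x` may lie in a gap of `K`; the last point of `K` to its left has the same
  -- projection.
  have hc : IsCompact (Iic x ∩ K) := hK.inter_left isClosed_Iic
  have hmem : sSup (Iic x ∩ K) ∈ Iic x ∩ K :=
    hc.sSup_mem ⟨sInf K, hx.1, hK.sInf_mem hne⟩
  refine ⟨_, hmem.2, ?_⟩
  rw [← hxt, proj_eq hK, proj_eq hK]
  congr 1
  ext u
  exact ⟨fun h => ⟨mem_Iic.2 ((mem_Iic.1 h.1).trans hmem.1), h.2⟩,
    fun h => ⟨le_csSup hc.bddAbove h, h.2⟩⟩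

lemma sel_mem_fiber (hK : IsCompact K) (hne : K.Nonempty) {t : ℝ}
    (ht : t ∈ Icc 0 (volume.real K)) : sel K t ∈ K ∧ proj K (sel K t) = t := by
  have hc : IsCompact {x ∈ K | proj K x = t} :=
    hK.inter_right (isClosed_singleton.preimage (proj_lipschitz hK).continuous)
  exact hc.sInf_mem (exists_mem_proj_eq hK hne ht)

lemma sel_proj_le (hK : IsCompact K) {x : ℝ} (hx : x ∈ K) : sel K (proj K x) ≤ x :=
  csInf_le (hK.bddBelow.mono fun _ h => h.1) ⟨hx, rfl⟩

lemma sel_monotoneOn (hK : IsCompact K) (hne : K.Nonempty) :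
    MonotoneOn (sel K) (Icc 0 (volume.real K)) := by
  intro s hs t ht hst
  by_contra! h
  have h1 := proj_mono hK h.le
  rw [(sel_mem_fiber hK hne hs).2, (sel_mem_fiber hK hne ht).2] at h1
  have : s = t := le_antisymm hst h1
  rw [this] at h
  exact lt_irrefl _ h

/-- A Galois connection: it turns the cut-off at `x` in `K` into the cut-off at `proj K x` in `[0,
|K|]`. -/
lemma sel_le_iff (hK : IsCompact K) (hne : K.Nonempty) {t x : ℝ}
    (ht : t ∈ Icc 0 (volume.real K)) (hx : x ∈ K) : sel K t ≤ x ↔ t ≤ proj K x := by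
  refine ⟨fun h => ?_, fun h => ?_⟩
  · rw [← (sel_mem_fiber hK hne ht).2]
    exact proj_mono hK h
  · exact (sel_monotoneOn hK hne ht (proj_mem_Icc hK x) h).trans (sel_proj_le hK hx)

lemma measurable_proj (hK : IsCompact K) : Measurable (proj K) := (proj_mono hK).measurable

lemma aemeasurable_sel (hK : IsCompact K) (hne : K.Nonempty) :
    AEMeasurable (sel K) (volume.restrict (Icc 0 (volume.real K))) :=
  aemeasurable_restrict_of_monotoneOn measurableSet_Icc (sel_monotoneOn hK hne)

/-- The measure projection pushes Lebesgue measure on `K` to Lebesgue measure on `[0, |K|]`. -/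
lemma map_proj (hK : IsCompact K) (hne : K.Nonempty) :
    Measure.map (proj K) (volume.restrict K) = volume.restrict (Icc 0 (volume.real K)) := by
  have : IsFiniteMeasure (volume.restrict K) := ⟨by simpa using hK.measure_lt_top⟩
  refine Measure.ext_of_Iic _ _ fun t => ?_
  rw [Measure.map_apply (measurable_proj hK) measurableSet_Iic,
    Measure.restrict_apply (measurable_proj hK measurableSet_Iic),
    Measure.restrict_apply measurableSet_Iic]
  rcases lt_or_ge t 0 with h0 | h0
  · have e1 : proj K ⁻¹' Iic t = ∅ := by
      ext x
      simpa using h0.trans_le (proj_nonneg x)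
    have e2 : Iic t ∩ Icc 0 (volume.real K) = ∅ := by
      ext x
      simp only [mem_inter_iff, mem_Iic, mem_Icc, mem_empty_iff_false, iff_false]
      rintro ⟨h1, h2, -⟩
      linarith
    rw [e1, e2, empty_inter, measure_empty]
  rcases lt_or_ge t (volume.real K) with h1 | h1
  · have e2 : Iic t ∩ Icc 0 (volume.real K) = Icc 0 t := by
      ext x
      simp only [mem_inter_iff, mem_Iic, mem_Icc]
      exact ⟨fun h => ⟨h.2.1, h.1⟩, fun h => ⟨h.2, h.1, h.2.trans h1.le⟩⟩
    -- Within `K` the sublevel set is cut off by its largest point `m`, and `proj K m = t` because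
    -- the value `t` is attained.
    have hc : IsCompact {x ∈ K | proj K x ≤ t} :=
      hK.inter_right (isClosed_Iic.preimage (proj_lipschitz hK).continuous)
    obtain ⟨x₀, hx₀, hx₀t⟩ := exists_mem_proj_eq hK hne (⟨h0, h1.le⟩ : t ∈ Icc 0 (volume.real K))
    have hm := hc.sSup_mem ⟨x₀, hx₀, hx₀t.le⟩
    set m := sSup {x ∈ K | proj K x ≤ t}
    have e1 : proj K ⁻¹' Iic t ∩ K = Iic m ∩ K := by
      ext x
      exact ⟨fun h => ⟨le_csSup hc.bddAbove ⟨h.2, h.1⟩, h.2⟩,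
        fun h => ⟨(proj_mono hK h.1).trans hm.2, h.2⟩⟩
    have hpm : proj K m = t :=
      le_antisymm hm.2 (hx₀t ▸ proj_mono hK (le_csSup hc.bddAbove ⟨hx₀, hx₀t.le⟩))
    rw [e1, e2, Real.volume_Icc, sub_zero, ← hpm, proj_eq hK, Measure.real,
      ENNReal.ofReal_toReal (volume_inter_ne_top hK _)]
  · have e1 : proj K ⁻¹' Iic t ∩ K = K :=
      inter_eq_right.2 fun x _ => (proj_le hK x).trans h1
    have e2 : Iic t ∩ Icc 0 (volume.real K) = Icc 0 (volume.real K) :=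
      inter_eq_right.2 fun x hx => hx.2.trans h1
    rw [e1, e2, Real.volume_Icc, sub_zero, Measure.real,
      ENNReal.ofReal_toReal hK.measure_lt_top.ne]

lemma measurePreserving_proj (hK : IsCompact K) (hne : K.Nonempty) :
    MeasurePreserving (proj K) (volume.restrict K) (volume.restrict (Icc 0 (volume.real K))) :=
  ⟨measurable_proj hK, map_proj hK hne⟩

/-- If `sel K (proj K x) < x`, then `proj K` is constant between the two points and hence takes at
`x` its value at some rational. These countably many values have null preimage, since `proj K`
preserves measure. -/
lemma ae_sel_proj (hK : IsCompact K) (hne : K.Nonempty) :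
    ∀ᵐ x ∂(volume.restrict K), sel K (proj K x) = x := by
  have hq : ∀ᵐ x ∂(volume.restrict K), ∀ q : ℚ, proj K x ≠ proj K q := by
    rw [ae_all_iff]
    intro q
    refine (measurePreserving_proj hK hne).quasiMeasurePreserving.ae
      (p := fun t => t ≠ proj K q) ?_
    exact Measure.ae_ne _ _
  filter_upwards [hq, ae_restrict_mem hK.measurableSet] with x hx hxK
  by_contra hne'
  have hlt := lt_of_le_of_ne (sel_proj_le hK hxK) hne'
  obtain ⟨q, hq1, hq2⟩ := exists_rat_btwn hlt
  have h1 := proj_mono hK hq1.le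
  rw [(sel_mem_fiber hK hne (proj_mem_Icc hK x)).2] at h1
  exact hx q (le_antisymm h1 (proj_mono hK hq2.le))

lemma map_sel (hK : IsCompact K) (hne : K.Nonempty) :
    Measure.map (sel K) (volume.restrict (Icc 0 (volume.real K))) = volume.restrict K := by
  have h := aemeasurable_sel hK hne
  rw [← map_proj hK hne] at h ⊢
  have h' : sel K ∘ proj K =ᵐ[volume.restrict K] id := ae_sel_proj hK hne
  rw [AEMeasurable.map_map_of_aemeasurable h (measurable_proj hK).aemeasurable,
    Measure.map_congr h', Measure.map_id]

/-- Properties holding a.e. on `K` correspond to properties holding a.e. on `[0, |K|]`. -/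
lemma ae_sel_of_ae (hK : IsCompact K) (hne : K.Nonempty) {p : ℝ → Prop}
    (h : ∀ᵐ x ∂(volume.restrict K), p x) :
    ∀ᵐ t ∂(volume.restrict (Icc 0 (volume.real K))), p (sel K t) := by
  rw [← map_sel hK hne] at h
  exact ae_of_ae_map (aemeasurable_sel hK hne) h

lemma ae_of_ae_sel (hK : IsCompact K) (hne : K.Nonempty) {p : ℝ → Prop}
    (h : ∀ᵐ t ∂(volume.restrict (Icc 0 (volume.real K))), p (sel K t)) :
    ∀ᵐ x ∂(volume.restrict K), p x := by
  filter_upwards [(measurePreserving_proj hK hne).quasiMeasurePreserving.ae h, ae_sel_proj hK hne]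
    with x hx hx'
  rwa [hx'] at hx

lemma aestronglyMeasurable_comp_sel (hK : IsCompact K) (hne : K.Nonempty) (f : LInf K) :
    AEStronglyMeasurable (fun t => f (sel K t)) (volume.restrict (Icc 0 (volume.real K))) := by
  have h : AEStronglyMeasurable f
      (Measure.map (sel K) (volume.restrict (Icc 0 (volume.real K)))) :=
    (map_sel hK hne).symm ▸ Lp.aestronglyMeasurable f
  exact h.comp_aemeasurable (aemeasurable_sel hK hne)

lemma exists_bound_comp_sel (hK : IsCompact K) (hne : K.Nonempty) (f : LInf K) :
    ∃ C : ℝ≥0, ∀ᵐ t ∂(volume.restrict (Icc 0 (volume.real K))), ‖f (sel K t)‖ ≤ C := by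
  refine ⟨‖f‖₊, ae_sel_of_ae hK hne (p := fun x => ‖f x‖ ≤ ‖f‖) ?_⟩
  have h := enorm_ae_le_eLpNormEssSup f (volume.restrict K)
  have hfin := Lp.eLpNorm_ne_top f
  filter_upwards [h] with x hx
  rw [← eLpNorm_exponent_top] at hx
  simpa [Lp.norm_def] using ENNReal.toReal_mono hfin hx

lemma integrableOn_comp_sel (hK : IsCompact K) (hne : K.Nonempty) (f : LInf K) :
    IntegrableOn (fun t => f (sel K t)) (Icc 0 (volume.real K)) := by
  obtain ⟨C, hC⟩ := exists_bound_comp_sel hK hne f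
  exact Integrable.of_bound (aestronglyMeasurable_comp_sel hK hne f) C hC

/-- The primitive on `K` is an ordinary primitive on `[0, |K|]`. -/
lemma primitive_eq_integral_sel (hK : IsCompact K) (hne : K.Nonempty) (f : LInf K) {x : ℝ}
    (hx : x ∈ K) : primitive K f x = ∫ t in 0..proj K x, f (sel K t) := by
  have hm := aemeasurable_sel hK hne
  have hf : AEStronglyMeasurable ((Iic x).indicator f)
      (Measure.map (sel K) (volume.restrict (Icc 0 (volume.real K)))) := by
    rw [map_sel hK hne]
    exact (Lp.aestronglyMeasurable f).indicator measurableSet_Iic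
  have h1 : primitive K f x = ∫ u, (Iic x).indicator f u ∂(volume.restrict K) := by
    rw [integral_indicator measurableSet_Iic, Measure.restrict_restrict measurableSet_Iic,
      primitive_eq hK]
  have h2 : ∫ u, (Iic x).indicator f u ∂(volume.restrict K) =
      ∫ t in Icc 0 (volume.real K), (Iic x).indicator f (sel K t) := by
    rw [← integral_map hm hf, map_sel hK hne]
  have h3 : ∫ t in Icc 0 (volume.real K), (Iic x).indicator f (sel K t) =
      ∫ t in Icc 0 (volume.real K), (Iic (proj K x)).indicator (fun t => f (sel K t)) t := by
    refine setIntegral_congr_fun measurableSet_Icc fun t ht => ?_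
    simp only [indicator, mem_Iic, sel_le_iff hK hne ht hx]
  rw [h1, h2, h3, integral_indicator measurableSet_Iic,
    Measure.restrict_restrict measurableSet_Iic, intervalIntegral.integral_of_le (proj_nonneg x),
    ← integral_Icc_eq_integral_Ioc]
  congr 2
  ext u
  simp only [mem_inter_iff, mem_Iic, mem_Icc]
  exact ⟨fun h => ⟨h.2.1, h.1⟩, fun h => ⟨h.2, h.1, h.2.trans (proj_le hK x)⟩⟩

/-- The primitive of `f` transported to `[0, |K|]` by the selector, as a linear map. -/
noncomputable def transportedPrimitive (hK : IsCompact K) : LInf K →ₗ[ℝ] (ℝ → ℝ) where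
  toFun f t := primitive K f (sel K t)
  map_add' f g := by
    ext t
    have : IsFiniteMeasure (volume.restrict K) := ⟨by simpa using hK.measure_lt_top⟩
    have hint : ∀ f : LInf K, Integrable f (volume.restrict (Iic (sel K t) ∩ K)) := fun f =>
      ((Lp.memLp f).integrable le_top).mono_measure (Measure.restrict_mono_set _ inter_subset_right)
    simp only [Pi.add_apply, primitive_eq hK]
    rw [← integral_add (hint f) (hint g)]
    exact integral_congr_ae (ae_mono (Measure.restrict_mono_set _ inter_subset_right)
      (Lp.coeFn_add f g))
  map_smul' c f := by
    ext t
    simp only [Pi.smul_apply, primitive_eq hK, RingHom.id_apply]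
    rw [← integral_smul]
    exact integral_congr_ae (ae_mono (Measure.restrict_mono_set _ inter_subset_right)
      (Lp.coeFn_smul c f))

lemma transportedPrimitive_eq (hK : IsCompact K) (hne : K.Nonempty)
    (f : LInf K) {t : ℝ} (ht : t ∈ Icc 0 (volume.real K)) :
    transportedPrimitive hK f t = ∫ u in 0..t, f (sel K u) := by
  have h := sel_mem_fiber hK hne ht
  change primitive K f (sel K t) = _
  rw [primitive_eq_integral_sel hK hne f h.1, h.2]

lemma primitive_eq_transported (hK : IsCompact K) (hne : K.Nonempty)
    (f : LInf K) {x : ℝ} (hx : x ∈ K) :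
    primitive K f x = transportedPrimitive hK f (proj K x) := by
  rw [transportedPrimitive_eq hK hne f (proj_mem_Icc hK x), primitive_eq_integral_sel hK hne f hx]

lemma intervalIntegrable_comp_sel (hK : IsCompact K) (hne : K.Nonempty)
    (f : LInf K) {s t : ℝ} (hs : s ∈ Icc 0 (volume.real K))
    (ht : t ∈ Icc 0 (volume.real K)) :
    IntervalIntegrable (fun u => f (sel K u)) volume s t :=
  ((integrableOn_comp_sel hK hne f).mono_set (uIcc_subset_Icc hs ht)).intervalIntegrable

/-- The primitive determines the function. -/
lemma transportedPrimitive_injective (hK : IsCompact K) (hne : K.Nonempty) {f g : LInf K}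
    (h : ∀ t ∈ Icc 0 (volume.real K), transportedPrimitive hK f t = transportedPrimitive hK g t) :
    f = g := by
  refine Lp.ext (ae_of_ae_sel hK hne (p := fun x => f x = g x) ?_)
  refine ae_eq_of_primitive_eq measureReal_nonneg (integrableOn_comp_sel hK hne f)
    (integrableOn_comp_sel hK hne g) fun t ht => ?_
  rw [← transportedPrimitive_eq hK hne f ht, ← transportedPrimitive_eq hK hne g ht, h t ht]

/-- For surjectivity, `F` is extended to a Lipschitz `G` on the line and `deriv G` is pulled back
along `proj K`. The bound on `deriv G` holds everywhere, as `deriv` is `0` where `G` is not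
differentiable; absolute continuity recovers `G` from it. -/
lemma rangeLip_transportedPrimitive (hK : IsCompact K) (hne : K.Nonempty) :
    RangeLip (volume.real K) (transportedPrimitive hK) := by
  have h0 : (0 : ℝ) ∈ Icc 0 (volume.real K) := ⟨le_rfl, measureReal_nonneg⟩
  refine ⟨fun f => ?_, fun f => ?_, fun F C hF hF0 => ?_⟩
  · obtain ⟨C, hC⟩ := exists_bound_comp_sel hK hne f
    refine ⟨C, LipschitzOnWith.of_dist_le_mul fun s hs t ht => ?_⟩
    rw [transportedPrimitive_eq hK hne f hs, transportedPrimitive_eq hK hne f ht, Real.dist_eq,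
      Real.dist_eq, intervalIntegral.integral_interval_sub_left
        (intervalIntegrable_comp_sel hK hne f h0 hs) (intervalIntegrable_comp_sel hK hne f h0 ht)]
    refine intervalIntegral.norm_integral_le_of_norm_le_const_ae (E := ℝ) ?_
    rw [ae_restrict_iff' measurableSet_Icc] at hC
    filter_upwards [hC] with u hu hu'
    exact hu (uIcc_subset_Icc ht hs (uIoc_subset_uIcc hu'))
  · rw [transportedPrimitive_eq hK hne f h0, intervalIntegral.integral_same]
  · obtain ⟨G, hG, hGF⟩ := hF.extend_real
    have hmeas : Measurable fun x => deriv G (proj K x) :=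
      (measurable_deriv G).comp (measurable_proj hK)
    have hmem : MemLp (fun x => deriv G (proj K x)) ⊤ (volume.restrict K) :=
      memLp_top_of_bound hmeas.aestronglyMeasurable C
        (Filter.Eventually.of_forall fun x => norm_deriv_le_of_lipschitz hG)
    refine ⟨hmem.toLp _, fun t ht => ?_⟩
    have hae := ae_sel_of_ae hK hne hmem.coeFn_toLp
    rw [transportedPrimitive_eq hK hne _ ht]
    have h1 : ∫ u in 0..t, hmem.toLp _ (sel K u) = ∫ u in 0..t, deriv G u := by
      refine intervalIntegral.integral_congr_ae ?_
      rw [ae_restrict_iff' measurableSet_Icc] at hae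
      filter_upwards [hae] with u hu hu'
      have hu'' := uIcc_subset_Icc h0 ht (uIoc_subset_uIcc hu')
      rw [hu hu'', (sel_mem_fiber hK hne hu'').2]
    rw [h1, (hG.lipschitzOnWith.absolutelyContinuousOnInterval).integral_deriv_eq_sub, hGF ht,
      ← hGF h0, hF0, sub_zero]

/-- The primitive takes the same values on `K` as its transport on `[0, |K|]`. Boundedness has to be
checked because `sSup` of an unbounded set is `0`. -/
lemma alexNorm_le_iff (hK : IsCompact K) (hne : K.Nonempty) (f : LInf K) (c : ℝ) :
    alexNorm K f ≤ c ↔ ∀ t ∈ Icc 0 (volume.real K), |transportedPrimitive hK f t| ≤ c := by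
  have himage : (fun x => |primitive K f x|) '' K =
      (fun t => |transportedPrimitive hK f t|) '' Icc 0 (volume.real K) := by
    ext v
    constructor
    · rintro ⟨x, hx, rfl⟩
      exact ⟨proj K x, proj_mem_Icc hK x, by simp only [primitive_eq_transported hK hne f hx]⟩
    · rintro ⟨t, ht, rfl⟩
      exact ⟨sel K t, (sel_mem_fiber hK hne ht).1, rfl⟩
  have hbdd : BddAbove ((fun t => |transportedPrimitive hK f t|) '' Icc 0 (volume.real K)) :=
    isCompact_Icc.bddAbove_image ((rangeLip_transportedPrimitive hK hne).continuousOn f).abs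
  rw [alexNorm, himage, csSup_le_iff hbdd ((nonempty_Icc.2 measureReal_nonneg).image _),
    forall_mem_image]

end Geometry

/-! ### Change of variables along a bi-Lipschitz homeomorphism -/

section ChangeOfVariables

variable {a b : ℝ} {ψ : ℝ → ℝ}

lemma volume_image_null_of_lipschitz {C : ℝ≥0} {G : ℝ → ℝ} (hG : LipschitzWith C G) {s : Set ℝ}
    (hs : volume s = 0) : volume (G '' s) = 0 := by
  have h := hG.hausdorffMeasure_image_le zero_le_one s
  rw [hausdorffMeasure_real, hs, mul_zero] at h
  exact le_antisymm h bot_le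

lemma IsIncreasingLipeo.map_zero (h : IsIncreasingLipeo b a ψ) (ha : 0 ≤ a) (hb : 0 ≤ b) :
    ψ 0 = 0 := by
  obtain ⟨z, hz, hz0⟩ := h.bijOn.surjOn (⟨le_rfl, ha⟩ : (0 : ℝ) ∈ Icc 0 a)
  have h0 : (0 : ℝ) ∈ Icc 0 b := ⟨le_rfl, hb⟩
  exact le_antisymm ((h.strictMonoOn.monotoneOn h0 hz hz.1).trans hz0.le) (h.bijOn.mapsTo h0).1

lemma IsIncreasingLipeo.image_Icc (h : IsIncreasingLipeo b a ψ) {t : ℝ}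
    (ht : t ∈ Icc 0 b) : ψ '' Icc 0 t = Icc 0 (ψ t) := by
  ext v
  constructor
  · rintro ⟨u, hu, rfl⟩
    have hu' : u ∈ Icc 0 b := ⟨hu.1, hu.2.trans ht.2⟩
    exact ⟨(h.bijOn.mapsTo hu').1, h.strictMonoOn.monotoneOn hu' ht hu.2⟩
  · intro hv
    obtain ⟨u, hu, rfl⟩ := h.bijOn.surjOn (⟨hv.1, hv.2.trans (h.bijOn.mapsTo ht).2⟩ : v ∈ Icc 0 a)
    exact ⟨u, ⟨hu.1, (h.strictMonoOn.le_iff_le hu ht).1 hv.2⟩, rfl⟩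

/-- A measurable subset of `[0, t]` of full measure on which `ψ` is differentiable, and whose image
has full measure in `[0, ψ t]`. -/
lemma IsIncreasingLipeo.exists_differentiable_subset (h : IsIncreasingLipeo b a ψ)
    {t : ℝ} (ht : t ∈ Icc 0 b) :
    ∃ S ⊆ Icc 0 t, MeasurableSet S ∧ S =ᵐ[volume] Icc 0 t ∧
      ψ '' S =ᵐ[volume] Icc 0 (ψ t) ∧
      ∀ x ∈ S, HasDerivWithinAt ψ (derivWithin ψ (Icc 0 b) x) S x := by
  obtain ⟨C, hC⟩ := h.lipschitz
  obtain ⟨G, hG, hGψ⟩ := hC.extend_real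
  have hsub : Icc 0 t ⊆ Icc 0 b := Icc_subset_Icc_right ht.2
  -- By Rademacher's theorem the Lipschitz extension `G` is differentiable a.e.; the discarded null
  -- set has null image because `G` is Lipschitz.
  let S := Icc 0 t ∩ {x | DifferentiableAt ℝ G x}
  have hSsub : S ⊆ Icc 0 t := inter_subset_left
  have hnull : volume (Icc 0 t \ S) = 0 := by
    refine measure_mono_null (fun x hx => ?_) (ae_iff.1 hG.ae_differentiableAt_real)
    exact fun hd => hx.2 ⟨hx.1, hd⟩
  refine ⟨S, hSsub, measurableSet_Icc.inter (measurableSet_of_differentiableAt ℝ G), ?_, ?_, ?_⟩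
  · exact Filter.EventuallyLE.antisymm (LE.le.eventuallyLE hSsub)
      (ae_le_set.2 hnull)
  · rw [← h.image_Icc ht]
    refine Filter.EventuallyLE.antisymm (LE.le.eventuallyLE (image_mono hSsub))
      (ae_le_set.2 ?_)
    refine measure_mono_null ?_ (volume_image_null_of_lipschitz hG hnull)
    rintro _ ⟨⟨x, hx, rfl⟩, hxS⟩
    exact ⟨x, ⟨hx, fun hx' => hxS ⟨x, hx', rfl⟩⟩, (hGψ (hsub hx)).symm⟩
  · intro x hx
    have hd : DifferentiableWithinAt ℝ ψ (Icc 0 b) x :=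
      hx.2.differentiableWithinAt.congr (fun y hy => hGψ hy) (hGψ (hsub hx.1))
    exact hd.hasDerivWithinAt.mono (hSsub.trans hsub)

/-- The monotone change of variables needs a derivative at every point, so it is applied on a subset
of full measure whose image also has full measure. -/
lemma IsIncreasingLipeo.integrableOn_comp (h : IsIncreasingLipeo b a ψ) (hb : 0 ≤ b)
    {F : ℝ → ℝ} (hF : IntegrableOn F (Icc 0 a)) :
    IntegrableOn (fun u => derivWithin ψ (Icc 0 b) u * F (ψ u)) (Icc 0 b) := by
  have hbb : b ∈ Icc 0 b := ⟨hb, le_rfl⟩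
  obtain ⟨S, hS, hSm, hSae, himg, hder⟩ := h.exists_differentiable_subset hbb
  rw [← integrableOn_congr_set_ae hSae]
  refine (integrableOn_image_iff_integrableOn_deriv_smul_of_monotoneOn hSm hder
    (h.strictMonoOn.monotoneOn.mono hS) F).1 ?_
  rw [integrableOn_congr_set_ae himg]
  exact hF.mono_set (Icc_subset_Icc_right (h.bijOn.mapsTo hbb).2)

lemma IsIncreasingLipeo.integral_comp (h : IsIncreasingLipeo b a ψ) (F : ℝ → ℝ)
    {t : ℝ} (ht : t ∈ Icc 0 b) :
    ∫ v in 0..ψ t, F v = ∫ u in 0..t, derivWithin ψ (Icc 0 b) u * F (ψ u) := by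
  obtain ⟨S, hS, hSm, hSae, himg, hder⟩ := h.exists_differentiable_subset ht
  rw [intervalIntegral.integral_of_le ht.1,
    intervalIntegral.integral_of_le (h.bijOn.mapsTo ht).1, ← integral_Icc_eq_integral_Ioc,
    ← integral_Icc_eq_integral_Ioc, ← setIntegral_congr_set himg, ← setIntegral_congr_set hSae]
  exact integral_image_eq_integral_deriv_smul_of_monotoneOn hSm hder
    (h.strictMonoOn.monotoneOn.mono (hS.trans (Icc_subset_Icc_right ht.2))) F

end ChangeOfVariables

/-! ### Both directions of the characterization, and the a.e. formula -/

section Main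

variable {K M : Set ℝ}

/-- The composition formula for primitives on `M`, transported to `[0, |M|]`. -/
lemma primitive_lift_iff (hK : IsCompact K) (hM : IsCompact M)
    (hMne : M.Nonempty) {ε : ℝ} {ψ : ℝ → ℝ} (f : LInf K) (g : LInf M) :
    (∀ y ∈ M, primitive M g y = ε * primitive K f (lift K M ψ y)) ↔
      ∀ s ∈ Icc 0 (volume.real M),
        transportedPrimitive hM g s = ε * transportedPrimitive hK f (ψ s) := by
  constructor
  · intro h s hs
    have hs' := sel_mem_fiber hM hMne hs
    have := h _ hs'.1
    rwa [lift, hs'.2] at this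
  · intro h y hy
    rw [primitive_eq_transported hM hMne g hy, h _ (proj_mem_Icc hM y)]
    rfl

lemma isSurjectiveIsometry_of_lift (hK : IsCompact K) (hM : IsCompact M)
    (hKne : K.Nonempty) (hMne : M.Nonempty) {T : LInf K →ₗ[ℝ] LInf M} {ε : ℝ} (hε : ε = 1 ∨ ε = -1)
    {ψ : ℝ → ℝ} (hψ : IsIncreasingLipeo (volume.real M) (volume.real K) ψ)
    (h : ∀ f, ∀ s ∈ Icc 0 (volume.real M),
      transportedPrimitive hM (T f) s = ε * transportedPrimitive hK f (ψ s)) :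
    IsSurjectiveIsometry T := by
  have habs : |ε| = 1 := by rcases hε with h | h <;> rw [h] <;> norm_num
  have hεε : ε * ε = 1 := by rcases hε with h | h <;> rw [h] <;> norm_num
  have hK0 : 0 ≤ volume.real K := measureReal_nonneg
  have hM0 : 0 ≤ volume.real M := measureReal_nonneg
  refine ⟨fun g => ?_, fun f => ?_⟩
  · set η := Function.invFunOn ψ (Icc 0 (volume.real M))
    have hinv : InvOn η ψ (Icc 0 (volume.real M)) (Icc 0 (volume.real K)) :=
      hψ.bijOn.invOn_invFunOn
    have hmaps : MapsTo η (Icc 0 (volume.real K)) (Icc 0 (volume.real M)) :=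
      hψ.bijOn.surjOn.mapsTo_invFunOn
    obtain ⟨C, hC⟩ := hψ.antilipschitz
    obtain ⟨D, hD⟩ := (rangeLip_transportedPrimitive hM hMne).lipschitz g
    have hηC : LipschitzOnWith C η (Icc 0 (volume.real K)) := by
      refine LipschitzOnWith.of_dist_le_mul fun x hx y hy => ?_
      have := hC.le_mul_dist ⟨η x, hmaps hx⟩ ⟨η y, hmaps hy⟩
      rwa [hinv.2 hx, hinv.2 hy] at this
    have hη0 : η 0 = 0 := by
      have := hinv.1 (⟨le_rfl, hM0⟩ : (0 : ℝ) ∈ Icc 0 (volume.real M))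
      rwa [hψ.map_zero hK0 hM0] at this
    -- The preimage of `g` is found through its primitive, `ε` times that of `g` composed with
    -- `ψ⁻¹`; this is Lipschitz because `ψ` is antilipschitz.
    obtain ⟨f, hf⟩ := (rangeLip_transportedPrimitive hK hKne).surj
      (transportedPrimitive hM g ∘ η) (D * C) (hD.comp hηC hmaps) (by
        rw [Function.comp_apply, hη0, (rangeLip_transportedPrimitive hM hMne).zero])
    refine ⟨ε • f, transportedPrimitive_injective hM hMne fun s hs => ?_⟩
    rw [h _ s hs, map_smul, Pi.smul_apply, smul_eq_mul, ← mul_assoc, hεε, one_mul,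
      hf _ (hψ.bijOn.mapsTo hs), Function.comp_apply, hinv.1 hs]
  · refine eq_of_forall_ge_iff fun c => ?_
    rw [alexNorm_le_iff hM hMne, alexNorm_le_iff hK hKne]
    constructor
    · intro hc t ht
      obtain ⟨s, hs, rfl⟩ := hψ.bijOn.surjOn ht
      have := hc s hs
      rwa [h f s hs, abs_mul, habs, one_mul] at this
    · intro hc s hs
      rw [h f s hs, abs_mul, habs, one_mul]
      exact hc _ (hψ.bijOn.mapsTo hs)

/-- Banach–Stone is applied on `LInf K` with the primitives of `f` and of `T f`; surjectivity of `T`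
ensures that the latter exhaust the Lipschitz functions vanishing at `0`. -/
lemma exists_lift_of_isSurjectiveIsometry (hK : IsCompact K) (hM : IsCompact M)
    (hKne : K.Nonempty) (hMne : M.Nonempty) (hK0 : 0 < volume.real K) (hM0 : 0 < volume.real M)
    {T : LInf K →ₗ[ℝ] LInf M} (hT : IsSurjectiveIsometry T) :
    ∃ ε : ℝ, (ε = 1 ∨ ε = -1) ∧ ∃ ψ : ℝ → ℝ,
      IsIncreasingLipeo (volume.real M) (volume.real K) ψ ∧
      ∀ f, ∀ s ∈ Icc 0 (volume.real M),
        transportedPrimitive hM (T f) s = ε * transportedPrimitive hK f (ψ s) := by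
  have hM' := rangeLip_transportedPrimitive hM hMne
  refine exists_lipeo_of_sup_isometry (A := transportedPrimitive hK)
    (B := transportedPrimitive hM ∘ₗ T) hK0 hM0 (rangeLip_transportedPrimitive hK hKne)
    ⟨fun f => hM'.lipschitz (T f), fun f => hM'.zero (T f), fun F C hF hF0 => ?_⟩ fun f c => ?_
  · obtain ⟨g, hg⟩ := hM'.surj F C hF hF0
    obtain ⟨f, rfl⟩ := hT.1 g
    exact ⟨f, hg⟩
  · rw [← alexNorm_le_iff hK hKne, ← hT.2 f, alexNorm_le_iff hM hMne]
    rfl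

/-- The composition formula for primitives is equivalent to its differentiated form a.e. -/
lemma transported_lift_iff_ae (hK : IsCompact K) (hM : IsCompact M)
    (hKne : K.Nonempty) (hMne : M.Nonempty) {ε : ℝ} {ψ : ℝ → ℝ}
    (hψ : IsIncreasingLipeo (volume.real M) (volume.real K) ψ) (f : LInf K) (g : LInf M) :
    (∀ s ∈ Icc 0 (volume.real M),
        transportedPrimitive hM g s = ε * transportedPrimitive hK f (ψ s)) ↔
      ∀ᵐ y ∂(volume.restrict M), g y = ε * f (lift K M ψ y) *
        derivWithin ψ (Icc 0 (volume.real M)) (proj M y) := by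
  have hM0 : 0 ≤ volume.real M := measureReal_nonneg
  -- By change of variables `G` is the density of the right-hand side, so the equivalence compares
  -- two integrable functions on `[0, |M|]` through their primitives.
  set G : ℝ → ℝ := fun u =>
    ε * (derivWithin ψ (Icc 0 (volume.real M)) u * f (sel K (ψ u))) with hGdef
  have hG : IntegrableOn G (Icc 0 (volume.real M)) :=
    (hψ.integrableOn_comp hM0 (integrableOn_comp_sel hK hKne f)).const_mul ε
  have hprim : ∀ s ∈ Icc 0 (volume.real M),
      ε * transportedPrimitive hK f (ψ s) = ∫ u in 0..s, G u := by
    intro s hs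
    rw [transportedPrimitive_eq hK hKne f (hψ.bijOn.mapsTo hs), hψ.integral_comp _ hs,
      ← intervalIntegral.integral_const_mul]
  have hpoint : ∀ s ∈ Icc 0 (volume.real M), ε * f (lift K M ψ (sel M s)) *
      derivWithin ψ (Icc 0 (volume.real M)) (proj M (sel M s)) = G s := by
    intro s hs
    rw [lift, (sel_mem_fiber hM hMne hs).2, hGdef]
    ring
  constructor
  · intro h
    refine ae_of_ae_sel hM hMne ?_
    filter_upwards [ae_eq_of_primitive_eq hM0 (integrableOn_comp_sel hM hMne g) hG fun s hs => by
      rw [← transportedPrimitive_eq hM hMne g hs, h s hs, hprim s hs],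
      ae_restrict_mem measurableSet_Icc] with s h1 hs
    rw [h1, hpoint s hs]
  · intro h s hs
    rw [hprim s hs, transportedPrimitive_eq hM hMne g hs]
    refine intervalIntegral.integral_congr_ae ?_
    have h' := ae_sel_of_ae hM hMne h
    rw [ae_restrict_iff' measurableSet_Icc] at h'
    filter_upwards [h'] with u hu hu'
    have hu'' : u ∈ Icc 0 (volume.real M) :=
      uIcc_subset_Icc ⟨le_rfl, hM0⟩ hs (uIoc_subset_uIcc hu')
    rw [hu hu'', hpoint u hu'']

end Main

end Alexiewicz


theorem theorem1p1 (K M : Set ℝ) (hK : IsCompact K) (hM : IsCompact M)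
    (hKpos : 0 < MeasureTheory.volume K) (hMpos : 0 < MeasureTheory.volume M)
    (T : Alexiewicz.LInf K →ₗ[ℝ] Alexiewicz.LInf M) :
    (Alexiewicz.IsSurjectiveIsometry T ↔
      ∃ ε : ℝ, (ε = 1 ∨ ε = -1) ∧
        ∃ ψ : ℝ → ℝ,
          Alexiewicz.IsIncreasingLipeo
            (MeasureTheory.volume.real M) (MeasureTheory.volume.real K) ψ ∧
          ∀ f : Alexiewicz.LInf K, ∀ y ∈ M,
            Alexiewicz.primitive M (T f) y
              = ε * Alexiewicz.primitive K f (Alexiewicz.lift K M ψ y)) ∧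
    (∀ ε : ℝ, (ε = 1 ∨ ε = -1) →
      ∀ ψ : ℝ → ℝ,
        Alexiewicz.IsIncreasingLipeo
          (MeasureTheory.volume.real M) (MeasureTheory.volume.real K) ψ →
        ∀ f : Alexiewicz.LInf K,
          ((∀ y ∈ M,
            Alexiewicz.primitive M (T f) y
              = ε * Alexiewicz.primitive K f (Alexiewicz.lift K M ψ y)) ↔
          ∀ᵐ y ∂(MeasureTheory.volume.restrict M),
            (T f) y = ε * f (Alexiewicz.lift K M ψ y) *
              derivWithin ψ (Set.Icc 0 (MeasureTheory.volume.real M))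
                (Alexiewicz.proj M y))) := by
  have hKne : K.Nonempty := MeasureTheory.nonempty_of_measure_ne_zero hKpos.ne'
  have hMne : M.Nonempty := MeasureTheory.nonempty_of_measure_ne_zero hMpos.ne'
  have hK0 : 0 < MeasureTheory.volume.real K :=
    ENNReal.toReal_pos hKpos.ne' hK.measure_lt_top.ne
  have hM0 : 0 < MeasureTheory.volume.real M :=
    ENNReal.toReal_pos hMpos.ne' hM.measure_lt_top.ne
  refine ⟨⟨fun hT => ?_, ?_⟩, fun ε _ ψ hψ f => ?_⟩
  · obtain ⟨ε, hε, ψ, hψ, h⟩ :=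
      Alexiewicz.exists_lift_of_isSurjectiveIsometry hK hM hKne hMne hK0 hM0 hT
    exact ⟨ε, hε, ψ, hψ, fun f =>
      (Alexiewicz.primitive_lift_iff hK hM hMne f (T f)).2 (h f)⟩
  · rintro ⟨ε, hε, ψ, hψ, h⟩
    exact Alexiewicz.isSurjectiveIsometry_of_lift hK hM hKne hMne hε hψ fun f =>
      (Alexiewicz.primitive_lift_iff hK hM hMne f (T f)).1 (h f)
  · exact (Alexiewicz.primitive_lift_iff hK hM hMne f (T f)).trans
      (Alexiewicz.transported_lift_iff_ae hK hM hKne hMne hψ f (T f))
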